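/- A \emph{tree order} is a partially ordered set $(E,\le)$ such that for every $e\in E$ the set ${\downarrow}e=\{x\in E\mid x\le e\}$ is finite and totally ordered. Its \emph{immediate predecessor function} $i_E:E\to E\sqcup\{\ast\}$ sends $e$ to $\max({\downarrow}e\smallsetminus\{e\})$ if ${\downarrow}e\neq\{e\}$, and to $\ast$ otherwise. A monotone map $f:E\to F$ between tree orders is \emph{strict} if $i_F\circ f=f_\ast\circ i_E$, where $f_\ast:E\sqcup\{\ast\}\to F\sqcup\{\ast\}$ extends $f$ by $f_\ast(\ast)=\ast$. Tree orders and strict maps form the category $\mathbf{Tree}$. A \emph{hierarchical graph} $\mathcal G$ consists of a tree order $(E_{\mathcal G},\le)$ of edges, a set $V_{\mathcal G}$ of nodes, and functions $s_{\mathcal G},t_{\mathcal G}:E_{\mathcal G}\to V_{\mathcal G}$. A morphism $\mathcal G\to\mathcal H$ is a pair $(f,g)$ with $f:E_{\mathcal G}\to E_{\mathcal H}$ in $\mathbf{Tree}$ and $g:V_{\mathcal G}\to V_{\mathcal H}$ a function such that $g\circ s_{\mathcal G}=s_{\mathcal H}\circ f$ and $g\circ t_{\mathcal G}=t_{\mathcal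 H}\circ f$. With componentwise composition this gives the category $\mathbf{HGraph}$. Let $\Delta:\mathbf{Set}\to\mathbf{HGraph}$ be the left adjoint of the functor $\mathbf{HGraph}\to\mathbf{Set}$, $\mathcal G\mapsto V_{\mathcal G}$; explicitly, $\Delta(X)$ has node set $X$ and no edges. The category $\mathbf{HIGraph}$ of \emph{hierarchical graphs with interface} is the comma category $(\Delta\downarrow \mathrm{id}_{\mathbf{HGraph}})$. \textbf{Theorem.} $\mathbf{HIGraph}$ is an adhesive category. That is, it has all pullbacks; every span $C\xleftarrow{m}A\xrightarrow{n}B$ with $m$ a monomorphism has a pushout; and every such pushout square is a Van Kampen square: for every commutative cube with this square as bottom face whose back faces (the faces over $m$ and $n$) are pullbacks, the top face is a pushout if and only if the two front faces are pullbacks. -/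

import Mathlib

open CategoryTheory

universe u

/-- A tree order: a partial order in which the set `{x | x ≤ e}` of predecessors of every
element `e` is finite and totally ordered. -/
structure TreeOrder : Type (u + 1) where
  carrier : Type u
  [order : PartialOrder carrier]
  finite_pred : ∀ e : carrier, (Set.Iic e).Finite
  chain_pred : ∀ e : carrier, IsChain (· ≤ ·) (Set.Iic e)

namespace TreeOrder

attribute [instance] TreeOrder.order

open Classical in
/-- The immediate predecessor function `i_E : E → E ⊔ {∗}`: it sends `e` to the greatest element of
`{x | x ≤ e} \ {e} = {x | x < e}` if there is one, and to `∗ = none` otherwise. -/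
noncomputable def immPred (E : TreeOrder.{u}) (e : E.carrier) : Option E.carrier :=
  if h : ∃ m, IsGreatest (Set.Iic e \ {e}) m then some h.choose else none

/-- If `e` has a predecessor other than itself, then the greatest such predecessor exists. -/
theorem exists_isGreatest (E : TreeOrder.{u}) {e : E.carrier} (he : Set.Iic e ≠ {e}) :
    ∃ m, IsGreatest (Set.Iic e \ {e}) m := by
  have hne : (Set.Iic e \ {e}).Nonempty := by
    by_contra h
    rw [Set.not_nonempty_iff_eq_empty, Set.sdiff_eq_empty] at h
    exact he (Set.Subset.antisymm h (by simp))
  obtain ⟨m, hm⟩ := ((E.finite_pred e).subset Set.sdiff_subset).exists_maximal hne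
  refine ⟨m, hm.1, fun x hx => ?_⟩
  rcases (E.chain_pred e).total hx.1 hm.1.1 with h | h
  · exact h
  · exact hm.2 hx h

theorem immPred_eq_some_iff (E : TreeOrder.{u}) (e m : E.carrier) :
    E.immPred e = some m ↔ IsGreatest (Set.Iic e \ {e}) m := by
  unfold immPred
  split_ifs with h
  · rw [Option.some_inj]
    exact ⟨fun hm => hm ▸ h.choose_spec, fun hm => h.choose_spec.unique hm⟩
  · simpa using fun hm => h ⟨m, hm⟩

theorem immPred_eq_none_iff (E : TreeOrder.{u}) (e : E.carrier) :
    E.immPred e = none ↔ Set.Iic e = {e} := by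
  unfold immPred
  split_ifs with h
  · obtain ⟨m, hm⟩ := h
    simp only [false_iff]
    intro he
    have := hm.1
    simp [he] at this
  · simp only [true_iff]
    by_contra he
    exact h (E.exists_isGreatest he)

/-- A strict morphism of tree orders: a monotone map commuting with the immediate predecessor
functions, `i_F ∘ f = f_∗ ∘ i_E`. -/
@[ext]
structure Hom (E F : TreeOrder.{u}) where
  toFun : E.carrier → F.carrier
  monotone : Monotone toFun
  strict : ∀ e, F.immPred (toFun e) = (E.immPred e).map toFun

/-- The category `Tree` of tree orders and strict morphisms. -/
instance : Category TreeOrder.{u} where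
  Hom := Hom
  id E := ⟨id, monotone_id, by simp⟩
  comp f g := ⟨g.toFun ∘ f.toFun, g.monotone.comp f.monotone,
    fun e => by simp [f.strict, g.strict]⟩

/-- The empty tree order, which is the initial object of `Tree`. -/
def empty : TreeOrder.{u} where
  carrier := PEmpty
  finite_pred := nofun
  chain_pred := nofun

/-- The unique morphism out of the empty tree order. -/
def fromEmpty (E : TreeOrder.{u}) : empty.{u} ⟶ E where
  toFun := PEmpty.elim
  monotone := nofun
  strict := nofun

/-- The empty tree order is initial. -/
theorem fromEmpty_unique (E : TreeOrder.{u}) (f : empty.{u} ⟶ E) : f = E.fromEmpty :=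
  Hom.ext (funext nofun)

end TreeOrder

/-- A hierarchical graph: a tree order of edges, a set of nodes, and source and target
functions. -/
structure HGraph : Type (u + 1) where
  edges : TreeOrder.{u}
  nodes : Type u
  source : edges.carrier → nodes
  target : edges.carrier → nodes

namespace HGraph

/-- A morphism of hierarchical graphs: a strict morphism between the tree orders of edges and a
function between the sets of nodes, compatible with sources and targets. -/
@[ext]
structure Hom (G H : HGraph.{u}) where
  onEdges : G.edges ⟶ H.edges
  onNodes : G.nodes → H.nodes
  source_comm : ∀ e, H.source (onEdges.toFun e) = onNodes (G.source e)
  target_comm : ∀ e, H.target (onEdges.toFun e) = onNodes (G.target e)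

/-- The category `HGraph` of hierarchical graphs, with componentwise composition. -/
instance : Category HGraph.{u} where
  Hom := Hom
  id G := ⟨𝟙 G.edges, id, fun _ => rfl, fun _ => rfl⟩
  comp f g := ⟨f.onEdges ≫ g.onEdges, g.onNodes ∘ f.onNodes,
    fun e => (g.source_comm _).trans (congrArg g.onNodes (f.source_comm e)),
    fun e => (g.target_comm _).trans (congrArg g.onNodes (f.target_comm e))⟩

/-- The forgetful functor `HGraph ⥤ Set` that only remembers the set of nodes. -/
def nodeFunctor : HGraph.{u} ⥤ Type u where
  obj G := G.nodes
  map f := TypeCat.ofHom f.onNodes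

/-- The functor `Δ : Set ⥤ HGraph`, sending a set `X` to the hierarchical graph with set of
nodes `X` and the empty tree order of edges. -/
def discrete : Type u ⥤ HGraph.{u} where
  obj X := ⟨TreeOrder.empty, X, PEmpty.elim, PEmpty.elim⟩
  map f := ⟨𝟙 TreeOrder.empty, f, nofun, nofun⟩

/-- `Δ` is left adjoint to the node-set functor. -/
def discreteAdjunction : discrete.{u} ⊣ nodeFunctor.{u} :=
  Adjunction.mkOfHomEquiv
    { homEquiv := fun _ G =>
        { toFun := fun f => TypeCat.ofHom f.onNodes
          invFun := fun f => ⟨G.edges.fromEmpty, f, nofun, nofun⟩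
          left_inv := fun _ => Hom.ext (G.edges.fromEmpty_unique _).symm rfl
          right_inv := fun _ => rfl }
      homEquiv_naturality_left_symm := fun _ _ =>
        Hom.ext (TreeOrder.fromEmpty_unique _ _).symm rfl
      homEquiv_naturality_right := fun _ _ => rfl }

end HGraph

/-- The category `HIGraph` of hierarchical graphs with interface, the comma category
`(Δ ↓ id_HGraph)`. -/
abbrev HIGraph : Type (u + 1) := Comma HGraph.discrete.{u} (𝟭 HGraph.{u})

/-! The depth of an edge is its number of strict predecessors. Strict maps preserve depth
(`Hom.depth_toFun`), so a tree order amounts to a tower of sets, its levels, linked by the immediate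
predecessor maps, and a strict map to a family of level maps commuting with them (`Hom.ofLevels`,
`ofTower`). Sources, targets and the interface map add further functions subject to no equations.
Hence `HIGraph` is equivalent to the category of set-valued functors on the free category of the
quiver `HIShape`. Such a functor category is adhesive because `Type u` is, and adhesivity transfers
along the equivalence `toPresheaf`. -/

namespace TreeOrder

/-! ### Depth, levels and strict maps -/

section Depth

variable {E F : TreeOrder.{u}}

theorem lt_iff_le_of_immPred_eq_some {e m x : E.carrier} (h : E.immPred e = some m) :
    x < e ↔ x ≤ m := by
  rw [immPred_eq_some_iff] at h
  refine ⟨fun hx => h.2 ⟨hx.le, hx.ne⟩, fun hx => hx.trans_lt ?_⟩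
  exact lt_of_le_of_ne h.1.1 h.1.2

theorem not_lt_of_immPred_eq_none {e x : E.carrier} (h : E.immPred e = none) : ¬ x < e := by
  rw [immPred_eq_none_iff] at h
  intro hx
  have : x ∈ Set.Iic e := hx.le
  rw [h] at this
  exact hx.ne this

theorem finite_Iio (e : E.carrier) : (Set.Iio e).Finite :=
  (E.finite_pred e).subset Set.Iio_subset_Iic_self

/-- The number of strict predecessors of an element of a tree order. -/
noncomputable def depth (e : E.carrier) : ℕ := (Set.Iio e).ncard

theorem depth_eq_succ {e m : E.carrier} (h : E.immPred e = some m) :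
    depth e = depth m + 1 := by
  have : Set.Iio e = insert m (Set.Iio m) := by
    ext x
    simp [lt_iff_le_of_immPred_eq_some h, le_iff_eq_or_lt]
  rw [depth, this, Set.ncard_insert_of_notMem (by simp) (finite_Iio m), depth]

theorem depth_eq_zero {e : E.carrier} (h : E.immPred e = none) : depth e = 0 := by
  have : Set.Iio e = ∅ := by
    ext x
    simpa using not_lt_of_immPred_eq_none h
  rw [depth, this, Set.ncard_empty]

/-- Induction along immediate predecessors. -/
theorem immPred_induction {P : E.carrier → Prop} (root : ∀ e, E.immPred e = none → P e)
    (succ : ∀ e m, E.immPred e = some m → P m → P e) (e : E.carrier) : P e := by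
  induction h : depth e generalizing e with
  | zero =>
    cases hm : E.immPred e with
    | none => exact root e hm
    | some m => rw [depth_eq_succ hm] at h; omega
  | succ n ih =>
    cases hm : E.immPred e with
    | none => exact root e hm
    | some m =>
      rw [depth_eq_succ hm] at h
      exact succ e m hm (ih m (by omega))

/-- An element strictly below `e` lies below the predecessor `m` of `e`, and `f m` is the
predecessor of `f e`; induction along predecessors concludes. Thus only strictness has to be checked
when constructing morphisms. -/
theorem monotone_of_strict {f : E.carrier → F.carrier}
    (hf : ∀ e, F.immPred (f e) = (E.immPred e).map f) : Monotone f := by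
  intro x y hxy
  induction y using immPred_induction with
  | root e h => rw [hxy.eq_of_not_lt (not_lt_of_immPred_eq_none h)]
  | succ e m h ih =>
    rcases hxy.eq_or_lt with rfl | hlt
    · exact le_rfl
    · have h' : F.immPred (f e) = some (f m) := by rw [hf, h]; rfl
      exact ((lt_iff_le_of_immPred_eq_some h').2
        (ih ((lt_iff_le_of_immPred_eq_some h).1 hlt))).le

/-- Strictness sends roots to roots and predecessors to predecessors. This is what lets a strict map
restrict to levels. -/
theorem Hom.depth_toFun (f : Hom E F) (e : E.carrier) : depth (f.toFun e) = depth e := by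
  induction e using immPred_induction with
  | root e h => rw [depth_eq_zero h, depth_eq_zero (by rw [f.strict, h]; rfl)]
  | succ e m h ih =>
    rw [depth_eq_succ h, depth_eq_succ (m := f.toFun m) (by rw [f.strict, h]; rfl), ih]

variable (E) in
/-- The elements of a given depth. -/
abbrev Level (n : ℕ) : Type u := {e : E.carrier // depth e = n}

theorem exists_immPred {n : ℕ} (e : E.Level (n + 1)) :
    ∃ m : E.Level n, E.immPred e.1 = some m.1 := by
  have he := e.2
  cases hm : E.immPred e.1 with
  | none => rw [depth_eq_zero hm] at he; omega
  | some m => exact ⟨⟨m, by rw [depth_eq_succ hm] at he; omega⟩, rfl⟩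

/-- The immediate predecessor, as a map between consecutive levels. -/
noncomputable def levelPred {n : ℕ} (e : E.Level (n + 1)) : E.Level n :=
  (exists_immPred e).choose

theorem immPred_level {n : ℕ} (e : E.Level (n + 1)) : E.immPred e.1 = some (levelPred e).1 :=
  (exists_immPred e).choose_spec

theorem levelPred_eq {n : ℕ} {e : E.Level (n + 1)} {m : E.Level n}
    (h : E.immPred e.1 = some m.1) : levelPred e = m :=
  Subtype.ext (Option.some_injective _ ((immPred_level e).symm.trans h))

/-- The map between levels induced by a strict morphism. -/
def Hom.onLevel (f : Hom E F) (n : ℕ) (e : E.Level n) : F.Level n :=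
  ⟨f.toFun e.1, (f.depth_toFun e.1).trans e.2⟩

theorem Hom.onLevel_levelPred (f : Hom E F) {n : ℕ} (e : E.Level (n + 1)) :
    f.onLevel n (levelPred e) = levelPred (f.onLevel (n + 1) e) :=
  (levelPred_eq (by
    change F.immPred (f.toFun e.1) = some (f.toFun (levelPred e).1)
    rw [f.strict, immPred_level]; rfl)).symm

/-- A family of maps between levels that commutes with immediate predecessors gives a strict
morphism. -/
noncomputable def Hom.ofLevels (φ : ∀ n, E.Level n → F.Level n)
    (hφ : ∀ n (e : E.Level (n + 1)), φ n (levelPred e) = levelPred (φ (n + 1) e)) : Hom E F :=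
  have key : ∀ e, F.immPred (φ (depth e) ⟨e, rfl⟩).1 =
      (E.immPred e).map fun e => (φ (depth e) ⟨e, rfl⟩).1 := by
    -- The depth of an element of `E.Level n` equals `n` only propositionally; `val` absorbs this
    -- transport.
    have val : ∀ (n : ℕ) (e : E.Level n), (φ (depth e.1) ⟨e.1, rfl⟩).1 = (φ n e).1 := by
      rintro _ ⟨e, rfl⟩; rfl
    intro e
    obtain ⟨n, hn⟩ : ∃ n, depth e = n := ⟨_, rfl⟩
    cases n with
    | zero =>
      have h₀ : E.immPred e = none := by
        cases hm : E.immPred e with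
        | none => rfl
        | some m => rw [depth_eq_succ hm] at hn; omega
      rw [h₀]
      cases hm : F.immPred (φ (depth e) ⟨e, rfl⟩).1 with
      | none => rfl
      | some m =>
        have := depth_eq_succ hm
        rw [(φ (depth e) ⟨e, rfl⟩).2] at this
        omega
    | succ n =>
      rw [val (n + 1) ⟨e, hn⟩, immPred_level, immPred_level (⟨e, hn⟩ : E.Level (n + 1)), ← hφ]
      exact congrArg some (val n _).symm
  ⟨fun e => (φ (depth e) ⟨e, rfl⟩).1, monotone_of_strict key, key⟩

theorem Hom.ofLevels_toFun (φ : ∀ n, E.Level n → F.Level n)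
    (hφ : ∀ n (e : E.Level (n + 1)), φ n (levelPred e) = levelPred (φ (n + 1) e))
    {n : ℕ} (e : E.Level n) : (Hom.ofLevels φ hφ).toFun e.1 = (φ n e).1 := by
  obtain ⟨e, rfl⟩ := e
  rfl

end Depth

/-! ### Tree orders from towers of sets -/

section Tower

variable {A : ℕ → Type u} (p : ∀ n, A (n + 1) → A n)

/-- The reachability relation on the disjoint union of a tower of sets. -/
inductive TowerLE : (Σ n, A n) → (Σ n, A n) → Prop
  | refl (x : Σ n, A n) : TowerLE x x
  | step {x : Σ n, A n} {n : ℕ} {y : A (n + 1)} : TowerLE x ⟨n, p n y⟩ → TowerLE x ⟨n + 1, y⟩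

variable {p}

theorem TowerLE.trans {x y z : Σ n, A n} (h : TowerLE p x y) (h' : TowerLE p y z) :
    TowerLE p x z := by
  induction h' with
  | refl => exact h
  | step _ ih => exact .step ih

/-- Each step raises the index by one. Antisymmetry of the order follows from this. -/
theorem TowerLE.eq_or_lt {x y : Σ n, A n} (h : TowerLE p x y) : x = y ∨ x.1 < y.1 := by
  induction h with
  | refl => exact .inl rfl
  | step _ ih =>
    rcases ih with rfl | h
    · exact .inr (Nat.lt_succ_self _)
    · exact .inr (h.trans (Nat.lt_succ_self _))

theorem towerLE_zero {x : Σ n, A n} {y : A 0} : TowerLE p x ⟨0, y⟩ ↔ x = ⟨0, y⟩ := by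
  constructor
  · intro h
    rcases h.eq_or_lt with h | h
    · exact h
    · exact absurd h (Nat.not_lt_zero _)
  · rintro rfl; exact .refl _

theorem towerLE_succ {x : Σ n, A n} {n : ℕ} {y : A (n + 1)} :
    TowerLE p x ⟨n + 1, y⟩ ↔ x = ⟨n + 1, y⟩ ∨ TowerLE p x ⟨n, p n y⟩ := by
  constructor
  · intro h
    cases h with
    | refl => exact .inl rfl
    | step h => exact .inr h
  · rintro (rfl | h)
    · exact .refl _
    · exact .step h

/-- Since `p` is a function, there is only one way down from `y`, so both elements lie on the same
descending path. -/
theorem TowerLE.total {x x' y : Σ n, A n} (h : TowerLE p x y) (h' : TowerLE p x' y) :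
    TowerLE p x x' ∨ TowerLE p x' x := by
  induction h with
  | refl => exact .inr h'
  | step h ih =>
    rcases towerLE_succ.1 h' with rfl | h'
    · exact .inl (.step h)
    · exact ih h'

theorem finite_towerLE (n : ℕ) (y : A n) : {x | TowerLE p x ⟨n, y⟩}.Finite := by
  induction n with
  | zero => simp [towerLE_zero]
  | succ n ih =>
    refine ((ih (p n y)).insert ⟨n + 1, y⟩).subset fun x hx => ?_
    exact towerLE_succ.1 hx

variable (p)

/-- The tree order with levels `A n` and immediate predecessors given by `p`. -/
def ofTower : TreeOrder.{u} where
  carrier := Σ n, A n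
  order :=
    { le := TowerLE p
      le_refl := .refl
      le_trans := fun _ _ _ => .trans
      le_antisymm := fun _ _ h h' => by
        rcases h.eq_or_lt with h | h
        · exact h
        · rcases h'.eq_or_lt with h' | h'
          · exact h'.symm
          · exact absurd h h'.not_gt }
  finite_pred := fun ⟨n, y⟩ => finite_towerLE n y
  chain_pred := fun _ _ h _ h' _ => TowerLE.total h h'

theorem immPred_ofTower_zero (y : A 0) : (ofTower p).immPred ⟨0, y⟩ = none := by
  refine (immPred_eq_none_iff _ _).2 (Set.ext fun x => ?_)
  exact towerLE_zero

theorem immPred_ofTower_succ (n : ℕ) (y : A (n + 1)) :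
    (ofTower p).immPred ⟨n + 1, y⟩ = some ⟨n, p n y⟩ := by
  refine (immPred_eq_some_iff _ _ _).2 ⟨⟨TowerLE.step (.refl _), fun h => ?_⟩, fun x hx => ?_⟩
  · exact absurd (congrArg Sigma.fst (Set.mem_singleton_iff.1 h)) (Nat.succ_ne_self n).symm
  · exact (towerLE_succ.1 hx.1).resolve_left hx.2

theorem depth_ofTower (n : ℕ) (y : A n) : depth (E := ofTower p) ⟨n, y⟩ = n := by
  induction n with
  | zero => exact depth_eq_zero (immPred_ofTower_zero p y)
  | succ n ih => rw [depth_eq_succ (immPred_ofTower_succ p n y), ih]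

/-- The levels of `ofTower p` are the given sets. -/
def levelOfTower (n : ℕ) (y : A n) : (ofTower p).Level n := ⟨⟨n, y⟩, depth_ofTower p n y⟩

/-- Depth in `ofTower p` is the sigma index, so a level is exactly one fibre. -/
theorem levelOfTower_bijective (n : ℕ) : Function.Bijective (levelOfTower p n) := by
  constructor
  · intro x y h
    exact eq_of_heq (Sigma.mk.inj (congrArg Subtype.val h)).2
  · rintro ⟨⟨m, y⟩, h⟩
    obtain rfl : m = n := (depth_ofTower p m y).symm.trans h
    exact ⟨y, rfl⟩

theorem levelPred_levelOfTower (n : ℕ) (y : A (n + 1)) :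
    levelPred (levelOfTower p (n + 1) y) = levelOfTower p n (p n y) :=
  levelPred_eq (immPred_ofTower_succ p n y)

end Tower

end TreeOrder

/-! ### The quiver and its path category -/

/-- The vertices of the quiver whose representations in sets are the hierarchical graphs with
interface: the edges of each depth, the nodes and the interface. -/
inductive HIShape : Type
  | edge (n : ℕ)
  | node
  | interface

/-- The arrows of the quiver whose representations are the hierarchical graphs with interface. -/
inductive HIShape.Arrow : HIShape → HIShape → Type
  | pred (n : ℕ) : Arrow (.edge (n + 1)) (.edge n)
  | source (n : ℕ) : Arrow (.edge n) .node
  | target (n : ℕ) : Arrow (.edge n) .node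
  | inclusion : Arrow .interface .node

instance : Quiver HIShape := ⟨HIShape.Arrow⟩

/-- Naturality between functors on a path category may be checked on arrows. -/
theorem CategoryTheory.Paths.naturality_of_arrows {V : Type*} [Quiver V] {C : Type*} [Category C]
    {F G : Paths V ⥤ C} (app : ∀ v : Paths V, F.obj v ⟶ G.obj v)
    (h : ∀ (a b : V) (e : a ⟶ b), F.map ((Paths.of V).map e) ≫ app ((Paths.of V).obj b) =
      app ((Paths.of V).obj a) ≫ G.map ((Paths.of V).map e))
    {a b : Paths V} (f : a ⟶ b) : F.map f ≫ app b = app a ≫ G.map f := by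
  induction f using Paths.induction with
  | id => simp
  | comp p q ih => rw [F.map_comp, G.map_comp, Category.assoc, h, reassoc_of% ih]

/-! ### Equivalence with set-valued functors -/

namespace HIGraph

/-- The sets constituting a hierarchical graph with interface. -/
def shapeObj (G : HIGraph.{u}) : HIShape → Type u
  | .edge n => G.right.edges.Level n
  | .node => G.right.nodes
  | .interface => G.left

/-- The structure maps of a hierarchical graph with interface. -/
noncomputable def shapeMap (G : HIGraph.{u}) : ∀ {a b : HIShape}, HIShape.Arrow a b →
    shapeObj G a → shapeObj G b
  | _, _, .pred _ => fun e => TreeOrder.levelPred e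
  | _, _, .source _ => fun e => G.right.source e.1
  | _, _, .target _ => fun e => G.right.target e.1
  | _, _, .inclusion => fun x => HGraph.Hom.onNodes G.hom x

/-- The components of a morphism of hierarchical graphs with interface. -/
def shapeHom {G H : HIGraph.{u}} (f : G ⟶ H) : ∀ a : HIShape, shapeObj G a → shapeObj H a
  | .edge n => TreeOrder.Hom.onLevel (HGraph.Hom.onEdges f.right) n
  | .node => HGraph.Hom.onNodes f.right
  | .interface => f.left

theorem onNodes_interface {G H : HIGraph.{u}} (f : G ⟶ H) (x : G.left) :
    HGraph.Hom.onNodes f.right (HGraph.Hom.onNodes G.hom x) =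
      HGraph.Hom.onNodes H.hom (f.left x) :=
  (congrFun (congrArg HGraph.Hom.onNodes f.w) x).symm

theorem shapeHom_shapeMap {G H : HIGraph.{u}} (f : G ⟶ H) {a b : HIShape}
    (e : HIShape.Arrow a b) (x : shapeObj G a) :
    shapeHom f b (shapeMap G e x) = shapeMap H e (shapeHom f a x) := by
  cases e with
  | pred n => exact TreeOrder.Hom.onLevel_levelPred _ x
  | source n => exact (HGraph.Hom.source_comm f.right x.1).symm
  | target n => exact (HGraph.Hom.target_comm f.right x.1).symm
  | inclusion => exact onNodes_interface f x

/-- The set-valued functor associated with a hierarchical graph with interface. -/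
noncomputable def presheaf (G : HIGraph.{u}) : Paths HIShape ⥤ Type u :=
  Paths.lift { obj := shapeObj G, map := fun e => TypeCat.ofHom (shapeMap G e) }

theorem presheaf_map_apply (G : HIGraph.{u}) {a b : HIShape} (e : a ⟶ b) (x : shapeObj G a) :
    (presheaf G).map ((Paths.of HIShape).map e) x = shapeMap G e x :=
  congrArg (fun f : shapeObj G a ⟶ shapeObj G b => f x)
    (Paths.lift_toPath { obj := shapeObj G, map := fun e => TypeCat.ofHom (shapeMap G e) } e)

/-- Hierarchical graphs with interface as set-valued functors on a path category. -/
noncomputable def toPresheaf : HIGraph.{u} ⥤ (Paths HIShape ⥤ Type u) where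
  obj := presheaf
  map {G H} f :=
    { app := fun a => TypeCat.ofHom (shapeHom f a)
      naturality := fun _ _ p => Paths.naturality_of_arrows
        (F := presheaf G) (G := presheaf H) (fun a => TypeCat.ofHom (shapeHom f a))
        (fun a b e => by
          ext x
          change shapeHom f b ((presheaf G).map ((Paths.of HIShape).map e) x) =
            (presheaf H).map ((Paths.of HIShape).map e) (shapeHom f a x)
          exact (congrArg (shapeHom f b) (presheaf_map_apply G e x)).trans
            ((shapeHom_shapeMap f e x).trans (presheaf_map_apply H e _).symm)) p }
  map_id G := by
    ext a x
    cases a <;> rfl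
  map_comp _ _ := by
    ext a x
    cases a <;> rfl

/-- Every edge lies in the level of its own depth, so the level maps determine the edge map. -/
theorem hom_ext {G H : HIGraph.{u}} {f g : G ⟶ H} (h : ∀ a x, shapeHom f a x = shapeHom g a x) :
    f = g := by
  refine CommaMorphism.ext ?_ ?_
  · ext x
    exact h .interface x
  · refine HGraph.Hom.ext (TreeOrder.Hom.ext (funext fun e => ?_)) (funext (h .node))
    exact congrArg Subtype.val (h (.edge _) ⟨e, rfl⟩)

instance : (toPresheaf.{u}).Faithful where
  map_injective {G H _ _} h := hom_ext fun a x =>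
    congrArg (fun α : presheaf G ⟶ presheaf H => α.app a x) h

/-- A family of maps commuting with all structure maps gives a morphism of hierarchical graphs
with interface. -/
noncomputable def homOfShape {G H : HIGraph.{u}} (φ : ∀ a, shapeObj G a → shapeObj H a)
    (hφ : ∀ {a b : HIShape} (e : HIShape.Arrow a b) x, φ b (shapeMap G e x) = shapeMap H e (φ a x)) :
    G ⟶ H where
  left := TypeCat.ofHom (φ .interface)
  right :=
    { onEdges := TreeOrder.Hom.ofLevels (fun n => φ (.edge n)) (fun n x => hφ (.pred n) x)
      onNodes := φ .node
      source_comm := fun e => (hφ (.source _) ⟨e, rfl⟩).symm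
      target_comm := fun e => (hφ (.target _) ⟨e, rfl⟩).symm }
  -- The edge component is automatic, as a discrete graph has no edges; the node component is
  -- compatibility with `inclusion`.
  w := HGraph.Hom.ext
    ((TreeOrder.fromEmpty_unique _ _).trans (TreeOrder.fromEmpty_unique _ _).symm)
    (funext fun x => (hφ .inclusion x).symm)

theorem shapeHom_homOfShape {G H : HIGraph.{u}} (φ : ∀ a, shapeObj G a → shapeObj H a)
    (hφ : ∀ {a b : HIShape} (e : HIShape.Arrow a b) x, φ b (shapeMap G e x) = shapeMap H e (φ a x))
    (a : HIShape) : shapeHom (homOfShape φ hφ) a = φ a := by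
  cases a with
  | edge n =>
    exact funext fun e => Subtype.ext
      (TreeOrder.Hom.ofLevels_toFun (fun n => φ (.edge n)) (fun n x => hφ (.pred n) x) e)
  | node => rfl
  | interface => rfl

theorem shapeMap_naturality {G : HIGraph.{u}} {P : Paths HIShape ⥤ Type u} (α : presheaf G ⟶ P)
    {a b : HIShape} (e : a ⟶ b) (x : shapeObj G a) :
    α.app ((Paths.of HIShape).obj b) (shapeMap G e x) =
      P.map ((Paths.of HIShape).map e) (α.app ((Paths.of HIShape).obj a) x) :=
  (congrArg (α.app ((Paths.of HIShape).obj b)) (presheaf_map_apply G e x).symm).trans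
    (NatTrans.naturality_apply α ((Paths.of HIShape).map e) x)

instance : (toPresheaf.{u}).Full where
  map_surjective {G H} α := by
    refine ⟨homOfShape (fun a => α.app ((Paths.of HIShape).obj a)) fun {a b} e x => ?_, ?_⟩
    · exact (shapeMap_naturality (P := presheaf H) α e x).trans (presheaf_map_apply H e _)
    · ext a x
      exact congrFun (shapeHom_homOfShape _ _ a) x

variable (P : Paths HIShape ⥤ Type u)

/-- The sets constituting a functor on the path category. -/
def vertexObj (a : HIShape) : Type u := P.obj ((Paths.of HIShape).obj a)

/-- The structure maps of a functor on the path category. -/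
def vertexMap {a b : HIShape} (e : HIShape.Arrow a b) (x : vertexObj P a) : vertexObj P b :=
  P.map ((Paths.of HIShape).map e) x

/-- The hierarchical graph with interface associated with a functor on the path category. -/
def ofPresheaf : HIGraph.{u} where
  left := vertexObj P .interface
  right :=
    { edges := TreeOrder.ofTower (A := fun n => vertexObj P (.edge n))
        fun n => vertexMap P (.pred n)
      nodes := vertexObj P .node
      source := fun e => vertexMap P (.source e.1) e.2
      target := fun e => vertexMap P (.target e.1) e.2 }
  hom :=
    { onEdges := TreeOrder.fromEmpty _
      onNodes := vertexMap P .inclusion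
      source_comm := nofun
      target_comm := nofun }

/-- The comparison between a functor and the sets of the associated graph. -/
def comparison : ∀ a, vertexObj P a → shapeObj (ofPresheaf P) a
  | .edge n => TreeOrder.levelOfTower (A := fun n => vertexObj P (.edge n))
      (fun n => vertexMap P (.pred n)) n
  | .node => id
  | .interface => id

theorem comparison_bijective (a : HIShape) : Function.Bijective (comparison P a) := by
  cases a with
  | edge n =>
    exact TreeOrder.levelOfTower_bijective (A := fun n => vertexObj P (.edge n))
      (fun n => vertexMap P (.pred n)) n
  | node => exact Function.bijective_id
  | interface => exact Function.bijective_id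

theorem shapeMap_comparison {a b : HIShape} (e : HIShape.Arrow a b) (x : vertexObj P a) :
    shapeMap (ofPresheaf P) e (comparison P a x) = comparison P b (vertexMap P e x) := by
  cases e with
  | pred n =>
    exact TreeOrder.levelPred_levelOfTower (A := fun n => vertexObj P (.edge n))
      (fun n => vertexMap P (.pred n)) n x
  | source n => rfl
  | target n => rfl
  | inclusion => rfl

/-- Every functor on the path category comes from a hierarchical graph with interface. -/
noncomputable def presheafOfPresheafIso : P ≅ presheaf (ofPresheaf P) :=
  NatIso.ofComponents (fun a => (Equiv.ofBijective _ (comparison_bijective P a)).toIso)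
    fun p => Paths.naturality_of_arrows (F := P) (G := presheaf (ofPresheaf P))
      (fun a => (Equiv.ofBijective _ (comparison_bijective P a)).toIso.hom)
      (fun a b e => by
        ext x
        exact ((presheaf_map_apply (ofPresheaf P) e (comparison P a x)).trans
          (shapeMap_comparison P e x)).symm) p

instance : (toPresheaf.{u}).EssSurj where
  mem_essImage P := ⟨ofPresheaf P, ⟨(presheafOfPresheafIso P).symm⟩⟩

instance : (toPresheaf.{u}).IsEquivalence where

end HIGraph

/-- `Adhesive` only demands pullbacks along monomorphisms, hence the separate first conjunct. -/
theorem mainTheorem6 : Limits.HasPullbacks HIGraph.{u} ∧ Adhesive HIGraph.{u} := by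
  have hl : Limits.HasPullbacks HIGraph.{u} :=
    Adjunction.hasLimitsOfShape_of_equivalence HIGraph.toPresheaf
  have hc : Limits.HasPushouts HIGraph.{u} :=
    Adjunction.hasColimitsOfShape_of_equivalence HIGraph.toPresheaf
  -- An equivalence preserves and reflects pullbacks and pushouts, so the Van Kampen property pulls
  -- back from the functor category.
  exact ⟨hl, adhesive_of_preserves_and_reflects HIGraph.toPresheaf⟩
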